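/- Let $d\ge 1$, let $\Omega=(a_1,b_1)\times\cdots\times(a_d,b_d)$ with $a_i<b_i$, and let $J_i\ge 2$ be integers, $h_i=\frac{b_i-a_i}{J_i-1}$, $h=\max_i h_i$. Let $\mathcal T_{\mathbf h}$ be the grid of the points $\mathbf x_\alpha=(a_i+(\alpha_i-1)h_i)_{i=1}^d$ with $1\le\alpha_i\le J_i$. Let $\theta>0$, $\beta\ge 0$, $\gamma>0$, $p\in[0,1]$, let $g$ be continuous on $\partial\Omega$, and let $H(\mathbf q,v,\mathbf x)$, $(\mathbf q,v,\mathbf x)\in\mathbb R^d\times\mathbb R\times\Omega$, be locally Lipschitz and nondecreasing in $v$. For grid functions $V$ put $$\nabla_{\mathbf h}V_\alpha=\Big(\tfrac{V_{\alpha+\mathbf e_i}-V_{\alpha-\mathbf e_i}}{2h_i}\Big)_{i=1}^d,\quad \delta_i^2V_\alpha=\tfrac{V_{\alpha+\mathbf e_i}-2V_\alpha+V_{\alpha-\mathbf e_i}}{h_i^2},\quad \Delta_{\mathbf h}V_\alpha=\sum_{i=1}^d\delta_i^2V_\alpha,\quad L_i^\pm V_\alpha=2V_{\alpha\pm\mathbf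 e_i}-V_{\alpha\pm2\mathbf e_i},$$ $$H_{\mathbf h}[V_\alpha]=-\beta h^2\Delta_{\mathbf h}V_\alpha+H(\nabla_{\mathbf h}V_\alpha,V_\alpha,\mathbf x_\alpha)+\theta V_\alpha,\qquad \widehat H_{\mathrm{LF}}[V_\alpha]=H_{\mathbf h}[V_\alpha]-\tfrac{\gamma}{2}h^p\Delta_{\mathbf h}V_\alpha .$$ The Lax–Friedrichs scheme is $\widehat H_{\mathrm{LF}}[U_\alpha]=0$ for $\mathbf x_\alpha\in\mathcal T_{\mathbf h}\cap\Omega$, $U_\alpha-g(\mathbf x_\alpha)=0$ for $\mathbf x_\alpha\in\mathcal T_{\mathbf h}\cap\partial\Omega$; a grid function is a subsolution (supersolution) of it if both equalities hold with $\le$ (with $\ge$) in place of $=$. Let $\underline U$ be a subsolution and $\overline U$ a supersolution of the Lax–Friedrichs scheme with $\underline U\le\overline U$ on $\mathcal T_{\mathbf h}$, and let $\overline{\underline S}$ be the set of grid functions $V$ with $\underline U\le V\le\overline U$ on $\mathcal T_{\mathbf h}$. Suppose that $\gamma$ is large enough that $\widehat H_{\mathrm{LF}}$ is monotone over $\overline{\underline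 S}$: for every $\mathbf x_\alpha\in\mathcal T_{\mathbf h}\cap\Omega$ and for $V$ ranging over $\overline{\underline S}$, $\widehat H_{\mathrm{LF}}[V_\alpha]$ is nondecreasing in the nodal value $V_\alpha$ and nonincreasing in each other nodal value $V_{\alpha'}$, $\alpha'\ne\alpha$. Let $\overline{\underline L}{}_i^\pm V_\alpha$ be $\overline U_\alpha$ if $L_i^\pm V_\alpha>\overline U_\alpha$, $\underline U_\alpha$ if $L_i^\pm V_\alpha<\underline U_\alpha$, and $L_i^\pm V_\alpha$ otherwise. Then, for either choice of the auxiliary boundary operator $B_{\mathbf h}$ below, there is a grid function $U$ (with values also at the ghost points just outside the grid) such that $\underline U\le U\le\overline U$ on $\mathcal T_{\mathbf h}$ and which solves the modified scheme $$\widehat H_{\mathrm{LF}}[U_\alpha]+\tfrac{\gamma}{2}h^p\sum_{i=1}^d\tfrac{1}{h_i^2}U_\alpha-\tfrac{\gamma}{4}h^p\sum_{i=1}^d\tfrac1{h_i^2}\big(\overline{\underline L}{}_i^+U_\alpha+\overline{\underline L}{}_i^-U_\alpha\big)=0\quad\text{if }\mathbf x_\alpha\in\mathcal T_{\mathbf h}\cap\Omega,$$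 $$U_\alpha-g(\mathbf x_\alpha)=0\quad\text{if }\mathbf x_\alpha\in\mathcal T_{\mathbf h}\cap\partial\Omega,\qquad B_{\mathbf h}U_\alpha=0\quad\text{if }\mathbf x_\alpha\in\mathcal S_{h_i},\ 1\le i\le d,$$ where $\mathcal S_{h_i}$ is the set of $\mathbf x_\alpha\in\mathcal T_{\mathbf h}\cap\partial\Omega$ one of whose neighbours $\mathbf x_{\alpha\pm\mathbf e_i}$ lies in $\mathcal T_{\mathbf h}\cap\Omega$, and for $\mathbf x_\alpha\in\mathcal S_{h_i}$ either $B_{\mathbf h}U_\alpha=-\delta_i^2U_\alpha$, or $B_{\mathbf h}U_\alpha=-\delta_i^2U_\alpha+\delta_i^2U_{\alpha'}$ with $\mathbf x_{\alpha'}$ that neighbour in $\mathcal T_{\mathbf h}\cap\Omega$. -/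

import Mathlib

open Set

noncomputable section

namespace LaxFriedrichs

/-- A `d`-rectangle `(a 1, b 1) × ⋯ × (a d, b d)` together with the numbers `J i` of grid points
in each coordinate direction. -/
structure Mesh (d : ℕ) where
  a : Fin d → ℝ
  b : Fin d → ℝ
  J : Fin d → ℕ
  a_lt_b : ∀ i, a i < b i
  two_le_J : ∀ i, 2 ≤ J i

/-- The data of the boundary value problem `H(∇u, u, x) + θ u = 0` in `Ω`, `u = g` on `∂Ω`
(`H q v x`), and the parameters `β, γ, p` of the difference schemes. -/
structure SchemeData (d : ℕ) where
  H : (Fin d → ℝ) → ℝ → (Fin d → ℝ) → ℝ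
  θ : ℝ
  g : (Fin d → ℝ) → ℝ
  β : ℝ
  γ : ℝ
  p : ℝ

/-- Families of real values indexed by the lattice `ℤ^d`. A grid function uses only the values at
the multi-indices in `Mesh.indices`; the values at ghost points are the ones at multi-indices next
to that set, and all other values are irrelevant. -/
abbrev GridFunction (d : ℕ) := (Fin d → ℤ) → ℝ

/-- The two auxiliary boundary conditions. -/
inductive AuxBC where
  | linear
  | quadratic

/-- The `i`-th unit multi-index. -/
def e {d : ℕ} (i : Fin d) : Fin d → ℤ := Pi.single i 1

namespace Mesh

variable {d : ℕ} (M : Mesh d)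

/-- The open `d`-rectangle. -/
def Ω : Set (Fin d → ℝ) := {x | ∀ i, x i ∈ Ioo (M.a i) (M.b i)}

/-- The mesh size `h i = (b i - a i) / (J i - 1)`. -/
def h (i : Fin d) : ℝ := (M.b i - M.a i) / ((M.J i : ℝ) - 1)

/-- `max_i h i` (for `d ≥ 1`). -/
def hmax : ℝ := ⨆ i, M.h i

/-- The point `x_α`. -/
def node (α : Fin d → ℤ) : Fin d → ℝ := fun i => M.a i + ((α i : ℝ) - 1) * M.h i

/-- The multi-indices `α` with `1 ≤ α i ≤ J i`, that is, the indices of the grid `𝒯_h`. -/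
def indices : Set (Fin d → ℤ) := {α | ∀ i, 1 ≤ α i ∧ α i ≤ (M.J i : ℤ)}

/-- The indices of `𝒯_h ∩ Ω`. -/
def interiorIndices : Set (Fin d → ℤ) := {α | α ∈ M.indices ∧ M.node α ∈ M.Ω}

/-- The indices of `𝒯_h ∩ ∂Ω`. -/
def boundaryIndices : Set (Fin d → ℤ) := {α | α ∈ M.indices ∧ M.node α ∈ frontier M.Ω}

/-- The indices of the boundary nodes that have an interior neighbour in direction `i`. -/
def sideIndices (i : Fin d) : Set (Fin d → ℤ) :=
  {α | α ∈ M.boundaryIndices ∧ (α + e i ∈ M.interiorIndices ∨ α - e i ∈ M.interiorIndices)}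

/-- Forward difference. -/
def δp (i : Fin d) (V : GridFunction d) (α : Fin d → ℤ) : ℝ := (V (α + e i) - V α) / M.h i

/-- Backward difference. -/
def δm (i : Fin d) (V : GridFunction d) (α : Fin d → ℤ) : ℝ := (V α - V (α - e i)) / M.h i

/-- Central discrete gradient. -/
def grad (V : GridFunction d) (α : Fin d → ℤ) : Fin d → ℝ :=
  fun i => (1 / 2) * (M.δp i V α + M.δm i V α)

/-- Second order central difference. -/
def δ2 (i : Fin d) (V : GridFunction d) (α : Fin d → ℤ) : ℝ :=
  (V (α + e i) - 2 * V α + V (α - e i)) / M.h i ^ 2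

/-- Discrete Laplacian. -/
def lap (V : GridFunction d) (α : Fin d → ℤ) : ℝ := ∑ i, M.δ2 i V α

/-- The order interval of all `V` with `Ulo ≤ V ≤ Uup` on the grid. -/
def orderInterval (Ulo Uup : GridFunction d) : Set (GridFunction d) :=
  {V | ∀ α ∈ M.indices, Ulo α ≤ V α ∧ V α ≤ Uup α}

/-- The grid operator `F` is monotone over `A`: at each interior node `α`, the value `F V α` is
nondecreasing in the nodal value `V α` and nonincreasing in every other nodal value, as long
as the grid functions stay in `A`. -/
def MonotoneOver (F : GridFunction d → (Fin d → ℤ) → ℝ) (A : Set (GridFunction d)) : Prop :=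
  ∀ α ∈ M.interiorIndices, ∀ α' ∈ M.indices, ∀ V ∈ A, ∀ W ∈ A,
    (∀ κ ∈ M.indices, κ ≠ α' → V κ = W κ) → V α' ≤ W α' →
      (α' = α → F V α ≤ F W α) ∧ (α' ≠ α → F W α ≤ F V α)

/-- The condition `B_h U_α = 0` at a node with index `α ∈ sideIndices i`. In the quadratic case,
`α'` is the interior neighbour of `α` in direction `i`. -/
def AuxCondition (bc : AuxBC) (i : Fin d) (U : GridFunction d) (α : Fin d → ℤ) : Prop :=
  match bc with
  | .linear => -M.δ2 i U α = 0
  | .quadratic => ∀ α' ∈ M.interiorIndices, (α' = α - e i ∨ α' = α + e i) →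
      -M.δ2 i U α + M.δ2 i U α' = 0

end Mesh

/-- `L_i^+ V_α`. -/
def Lp {d : ℕ} (i : Fin d) (V : GridFunction d) (α : Fin d → ℤ) : ℝ :=
  2 * V (α + e i) - V (α + 2 • e i)

/-- `L_i^- V_α`. -/
def Lm {d : ℕ} (i : Fin d) (V : GridFunction d) (α : Fin d → ℤ) : ℝ :=
  2 * V (α - e i) - V (α - 2 • e i)

open Classical in
/-- The truncation of the value `t` by the lower bound `lo` and the upper bound `up`. -/
def cutoff (lo up t : ℝ) : ℝ := if t > up then up else if t < lo then lo else t

namespace SchemeData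

variable {d : ℕ} (P : SchemeData d) (M : Mesh d)

/-- `H_h[V_α] = -β h² Δ_h V_α + H(∇_h V_α, V_α, x_α) + θ V_α`. -/
def Hh (V : GridFunction d) (α : Fin d → ℤ) : ℝ :=
  -P.β * M.hmax ^ 2 * M.lap V α + P.H (M.grad V α) (V α) (M.node α) + P.θ * V α

/-- The Lax-Friedrichs operator `H_h - (γ / 2) h^p Δ_h`. -/
def HLF (V : GridFunction d) (α : Fin d → ℤ) : ℝ :=
  P.Hh M V α - P.γ / 2 * M.hmax ^ P.p * M.lap V α

/-- The operator of the modified scheme, with cutoff functions `Ulo` and `Uup`. -/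
def Hmod (Ulo Uup V : GridFunction d) (α : Fin d → ℤ) : ℝ :=
  P.HLF M V α + P.γ * M.hmax ^ P.p * (1 / 2) * (∑ i, 1 / M.h i ^ 2 * V α)
    - P.γ * M.hmax ^ P.p * (1 / 4) *
      ∑ i, 1 / M.h i ^ 2 *
        (cutoff (Ulo α) (Uup α) (Lp i V α) + cutoff (Ulo α) (Uup α) (Lm i V α))

/-- Discrete subsolutions of the Lax-Friedrichs scheme. -/
def IsSubsolution (U : GridFunction d) : Prop :=
  (∀ α ∈ M.interiorIndices, P.HLF M U α ≤ 0) ∧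
    ∀ α ∈ M.boundaryIndices, U α - P.g (M.node α) ≤ 0

/-- Discrete supersolutions of the Lax-Friedrichs scheme. -/
def IsSupersolution (U : GridFunction d) : Prop :=
  (∀ α ∈ M.interiorIndices, 0 ≤ P.HLF M U α) ∧
    ∀ α ∈ M.boundaryIndices, 0 ≤ U α - P.g (M.node α)

/-- Solutions (with their ghost values) of the modified scheme with cutoff functions
`Ulo` and `Uup` and auxiliary boundary condition `bc`. -/
def IsModifiedSolution (bc : AuxBC) (Ulo Uup U : GridFunction d) : Prop :=
  (∀ α ∈ M.interiorIndices, P.Hmod M Ulo Uup U α = 0) ∧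
    (∀ α ∈ M.boundaryIndices, U α - P.g (M.node α) = 0) ∧
      ∀ i, ∀ α ∈ M.sideIndices i, M.AuxCondition bc i U α

end SchemeData

end LaxFriedrichs

end

/-! The unknowns are the interior nodal values: the boundary values are those of `g`, and the
auxiliary condition gives each relevant ghost value explicitly from grid values. The scheme is thus
a zero of a continuous field on the box between `Ulo` and `Uup`, and Poincaré–Miranda applies once
the signs on the faces are right. On a face where `V α = Uup α`, monotonicity compares `HLF` at `V`
with `HLF` at `Uup`, which is nonnegative, and the extra term is nonnegative since truncated values
do not exceed `Uup α`. The lower faces are symmetric. Ghost values enter only through the truncated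
terms, so no bound on them is needed. Poincaré–Miranda follows from a zero theorem for `x + b x`.
For smooth compactly supported `b`, the integral of `det (1 + t Db) * φ (x + t b)` over a large ball
is a polynomial in `t` when `φ` is polynomial along lines. Change of variables makes it constant for
small `t > 0`, hence also at `t = 1`. Powers of a bump peaked at `0` contradict this if `x + b x`
avoids a neighbourhood of `0`. -/

noncomputable section

/-! ### Zeros of perturbations of the identity -/

section ZeroOfPerturbedIdentity

open MeasureTheory Metric Filter Topology Polynomial

variable {E : Type*} [NormedAddCommGroup E] [InnerProductSpace ℝ E] [FiniteDimensional ℝ E]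

/-- The determinant of `1 + t • A` is a polynomial in `t`. -/
theorem exists_polynomial_eval_eq_det_one_add_smul (A : E →L[ℝ] E) :
    ∃ p : ℝ[X], p.natDegree ≤ Module.finrank ℝ E ∧
      ∀ t : ℝ, p.eval t = (ContinuousLinearMap.id ℝ E + t • A).det := by
  classical
  set v := Module.finBasis ℝ E
  set m := LinearMap.toMatrix v v (A : E →ₗ[ℝ] E)
  refine ⟨Matrix.det ((X : ℝ[X]) • m.map C + (1 : Matrix _ _ ℝ).map C), ?_, fun t => ?_⟩
  · simpa using natDegree_det_X_add_C_le m 1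
  · have h : (ContinuousLinearMap.id ℝ E + t • A).det =
        Matrix.det (1 + t • m) := by
      rw [ContinuousLinearMap.det, ← LinearMap.det_toMatrix v]
      simp [m]
    rw [h, ← coe_evalRingHom, RingHom.map_det]
    congr 1
    ext i j
    simp only [RingHom.mapMatrix_apply, Matrix.map_apply, Matrix.add_apply, Matrix.smul_apply,
      smul_eq_mul, map_add, coe_evalRingHom, eval_mul, eval_X, eval_C]
    ring

/-- If `q` has degree at most `m`, then its value at `1` is a fixed affine combination of its values
at `m + 1` prescribed points. -/
theorem exists_interpolation_weights {ε : ℝ} (hε : 0 < ε) (m : ℕ) :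
    ∃ w t : ℕ → ℝ, (∀ k ∈ Finset.range (m + 1), t k ∈ Ioo 0 ε) ∧
      ∀ q : ℝ[X], q.natDegree ≤ m → q.eval 1 = ∑ k ∈ Finset.range (m + 1), w k * q.eval (t k) := by
  -- The nodes need only be distinct and inside `(0, ε)`; `k + 2` keeps node `0` strictly below `ε`.
  set t : ℕ → ℝ := fun k => ε / (k + 2)
  have hinj : Set.InjOn t (Finset.range (m + 1)) := by
    intro i _ j _ hij
    have h1 : (0 : ℝ) < i + 2 := by positivity
    have h2 : (0 : ℝ) < j + 2 := by positivity
    simp only [t] at hij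
    rw [div_eq_div_iff h1.ne' h2.ne'] at hij
    have := mul_left_cancel₀ hε.ne' hij
    exact_mod_cast (by linarith : (i : ℝ) = j)
  refine ⟨fun k => (Lagrange.basis (Finset.range (m + 1)) t k).eval 1, t, fun k _ => ⟨?_, ?_⟩,
    fun q hq => ?_⟩
  · simp only [t]; positivity
  · simp only [t]
    rw [div_lt_iff₀ (by positivity)]
    nlinarith [(Nat.cast_nonneg k : (0 : ℝ) ≤ k)]
  · have hdeg : q.degree < (Finset.range (m + 1)).card := by
      rw [Finset.card_range]
      exact lt_of_le_of_lt degree_le_natDegree (by exact_mod_cast Nat.lt_succ_of_le hq)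
    conv_lhs => rw [Lagrange.eq_interpolate hinj hdeg]
    simp [Lagrange.interpolate_apply, eval_finsetSum, mul_comm]

section ChangeOfVariables

variable [MeasurableSpace E] [BorelSpace E]

/-- Change of variables for a small perturbation of the identity. -/
theorem exists_setIntegral_det_mul_eq_of_small {b : E → E} (hb : ContDiff ℝ 1 b) {R : ℝ}
    (hsupp : Function.support b ⊆ closedBall 0 R) (φ : E → ℝ) :
    ∃ ε > 0, ∀ t ∈ Ioo (0 : ℝ) ε,
      ∫ x in closedBall (0 : E) R,
        (ContinuousLinearMap.id ℝ E + t • fderiv ℝ b x).det * φ (x + t • b x) =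
      ∫ x in closedBall (0 : E) R, φ x := by
  have hcs : HasCompactSupport b :=
    HasCompactSupport.of_support_subset_isCompact (isCompact_closedBall 0 R) hsupp
  obtain ⟨K, hK⟩ := hb.lipschitzWith_of_hasCompactSupport hcs one_ne_zero
  have hdet : ∀ᶠ A : E →L[ℝ] E in 𝓝 0, 0 < (ContinuousLinearMap.id ℝ E + A).det := by
    have : ContinuousAt (fun A : E →L[ℝ] E => (ContinuousLinearMap.id ℝ E + A).det) 0 :=
      (ContinuousLinearMap.continuous_det.comp (by fun_prop)).continuousAt
    refine this.eventually_const_lt ?_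
    simp [ContinuousLinearMap.det]
  obtain ⟨δ, hδ, hdet⟩ := Metric.eventually_nhds_iff.1 hdet
  -- The first bound makes `t • b` a contraction, so the map is bijective; the second keeps the
  -- determinant positive. `K + 1` avoids dividing by zero.
  refine ⟨min (1 / (K + 1)) (δ / (K + 1)), by positivity, fun t ht => ?_⟩
  have hK1 : (0 : ℝ) < K + 1 := by positivity
  have ht0 : 0 < t := ht.1
  have ht1 : t * K < 1 := by
    have := (lt_div_iff₀ hK1).1 (ht.2.trans_le (min_le_left _ _)); nlinarith
  have ht2 : t * K < δ := by
    have := (lt_div_iff₀ hK1).1 (ht.2.trans_le (min_le_right _ _)); nlinarith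
  set f : E → E := fun x => x + t • b x
  have hfd : ∀ x, HasFDerivAt f (ContinuousLinearMap.id ℝ E + t • fderiv ℝ b x) x := fun x =>
    (hasFDerivAt_id x).add (((hb.differentiable one_ne_zero) x).hasFDerivAt.const_smul t)
  have hpos : ∀ x, 0 < (ContinuousLinearMap.id ℝ E + t • fderiv ℝ b x).det := fun x => by
    refine hdet ?_
    rw [dist_zero_right, norm_smul, Real.norm_of_nonneg ht0.le]
    exact (mul_le_mul_of_nonneg_left (norm_fderiv_le_of_lipschitz ℝ hK) ht0.le).trans_lt ht2
  have happ : ApproximatesLinearOn f ((ContinuousLinearEquiv.refl ℝ E : E ≃L[ℝ] E) : E →L[ℝ] E)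
      univ (t.toNNReal * K) := by
    intro x _ y _
    have : f x - f y - ((ContinuousLinearEquiv.refl ℝ E : E ≃L[ℝ] E) : E →L[ℝ] E) (x - y) =
        t • (b x - b y) := by
      simp only [f, ContinuousLinearEquiv.coe_coe, ContinuousLinearEquiv.coe_refl', id, smul_sub]
      abel
    rw [this, norm_smul, Real.norm_of_nonneg ht0.le, NNReal.coe_mul, Real.coe_toNNReal _ ht0.le,
      mul_assoc]
    exact mul_le_mul_of_nonneg_left (by simpa [dist_eq_norm] using hK.dist_le_mul x y) ht0.le
  have hc : Subsingleton E ∨ t.toNNReal * K <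
      ‖((ContinuousLinearEquiv.refl ℝ E : E ≃L[ℝ] E).symm : E →L[ℝ] E)‖₊⁻¹ := by
    rcases subsingleton_or_nontrivial E with h | h
    · exact Or.inl h
    · right
      have : ‖((ContinuousLinearEquiv.refl ℝ E : E ≃L[ℝ] E).symm : E →L[ℝ] E)‖₊ = 1 := by
        have := ContinuousLinearMap.norm_id (𝕜 := ℝ) (E := E)
        exact NNReal.eq this
      rw [this, inv_one, ← NNReal.coe_lt_coe]
      simpa [Real.coe_toNNReal _ ht0.le] using ht1
  have hinj : Function.Injective f := injOn_univ.1 (happ.injOn hc)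
  have hsurj : Function.Surjective f := happ.surjective hc
  -- A bijection fixing every point off the ball maps the ball onto itself.
  have himg : f '' closedBall 0 R = closedBall 0 R := by
    have h1 : f '' (closedBall 0 R)ᶜ = (closedBall 0 R)ᶜ := by
      have : EqOn f id (closedBall 0 R)ᶜ := fun x hx => by
        have : b x = 0 := by
          by_contra h
          exact hx (hsupp h)
        simp [f, this]
      rw [this.image_eq, image_id]
    rw [image_compl_eq ⟨hinj, hsurj⟩] at h1
    exact compl_injective h1
  have := integral_image_eq_integral_abs_det_fderiv_smul volume
    (isClosed_closedBall (x := (0 : E)) (ε := R)).measurableSet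
    (fun x _ => (hfd x).hasFDerivWithinAt) hinj.injOn φ
  rw [himg] at this
  rw [this]
  refine setIntegral_congr_fun isClosed_closedBall.measurableSet fun x _ => ?_
  simp only [smul_eq_mul, abs_of_pos (hpos x), f]

/-- The change of variables formula for a map that is the identity off a ball, applied to a
function that is polynomial of bounded degree along lines. -/
theorem setIntegral_det_mul_eq {b : E → E} (hb : ContDiff ℝ 1 b) {R : ℝ}
    (hsupp : Function.support b ⊆ closedBall 0 R) {φ : E → ℝ} (hφ : Continuous φ) {m : ℕ}
    (hpoly : ∀ x v : E, ∃ p : ℝ[X], p.natDegree ≤ m ∧ ∀ t, p.eval t = φ (x + t • v)) :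
    ∫ x in closedBall (0 : E) R, (ContinuousLinearMap.id ℝ E + fderiv ℝ b x).det * φ (x + b x) =
      ∫ x in closedBall (0 : E) R, φ x := by
  obtain ⟨ε, hε, hsmall⟩ := exists_setIntegral_det_mul_eq_of_small hb hsupp φ
  obtain ⟨w, t, ht, hw⟩ := exists_interpolation_weights hε (Module.finrank ℝ E + m)
  have hsum : ∑ k ∈ Finset.range (Module.finrank ℝ E + m + 1), w k = 1 := by
    simpa using (hw 1 (by simp)).symm
  -- The integrand is a polynomial in `t` with a degree bound uniform in `x`, so the same weights
  -- extrapolate from small `t` to `t = 1` at every point.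
  have hpt : ∀ x, (ContinuousLinearMap.id ℝ E + fderiv ℝ b x).det * φ (x + b x) =
      ∑ k ∈ Finset.range (Module.finrank ℝ E + m + 1), w k *
        ((ContinuousLinearMap.id ℝ E + t k • fderiv ℝ b x).det * φ (x + t k • b x)) := by
    intro x
    obtain ⟨p, hp, hpe⟩ := exists_polynomial_eval_eq_det_one_add_smul (fderiv ℝ b x)
    obtain ⟨q, hq, hqe⟩ := hpoly x (b x)
    have := hw (p * q) (natDegree_mul_le.trans (add_le_add hp hq))
    simpa [eval_mul, hpe, hqe] using this
  have hint : ∀ s : ℝ, IntegrableOn (fun x =>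
      (ContinuousLinearMap.id ℝ E + s • fderiv ℝ b x).det * φ (x + s • b x))
      (closedBall (0 : E) R) := by
    intro s
    refine ContinuousOn.integrableOn_compact (isCompact_closedBall 0 R) (Continuous.continuousOn ?_)
    have h1 := hb.continuous
    have h2 := hb.continuous_fderiv one_ne_zero
    exact (ContinuousLinearMap.continuous_det.comp (by fun_prop)).mul (hφ.comp (by fun_prop))
  simp_rw [hpt]
  rw [integral_finsetSum _ fun k _ => (hint (t k)).const_mul _]
  simp_rw [integral_const_mul]
  rw [Finset.sum_congr rfl fun k hk => by rw [hsmall (t k) (ht k hk)], ← Finset.sum_mul, hsum,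
    one_mul]

end ChangeOfVariables

/-- A compactly supported `C¹` perturbation of the identity has a zero. -/
theorem exists_add_eq_zero_of_contDiff {b : E → E} (hb : ContDiff ℝ 1 b)
    (hcs : HasCompactSupport b) : ∃ x, x + b x = 0 := by
  borelize E
  by_contra! hne
  obtain ⟨R, hR, hsupp⟩ : ∃ R : ℝ, 0 < R ∧ Function.support b ⊆ closedBall 0 R := by
    obtain ⟨R, hR⟩ := hcs.isCompact.isBounded.subset_closedBall 0
    exact ⟨max R 1, by positivity, (subset_tsupport b).trans
      (hR.trans (closedBall_subset_closedBall (le_max_left _ _)))⟩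
  have hbc := hb.continuous
  have hK := isCompact_closedBall (0 : E) R
  obtain ⟨x₀, -, hx₀⟩ := hK.exists_isMinOn ⟨0, by simp [hR.le]⟩
    (f := fun x => ‖x + b x‖) (by fun_prop)
  -- Capping by `R` puts the ball of radius `r / 2` inside the domain of integration.
  set r := min R ‖x₀ + b x₀‖
  have hr : 0 < r := lt_min hR (norm_pos_iff.2 (hne x₀))
  have hlow : ∀ x ∈ closedBall (0 : E) R, r ≤ ‖x + b x‖ := fun x hx =>
    (min_le_right _ _).trans (hx₀ hx)
  obtain ⟨C₀, hC₀⟩ := hK.exists_bound_of_continuousOn (f := fun x => x + b x) (by fun_prop)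
  -- `D` bounds both `‖x‖` and `‖x + b x‖` on the ball, so the bump below is nonnegative at both.
  set D := max C₀ R
  have hD : 0 < D := lt_max_of_lt_right hR
  have hrD : r ≤ D := (min_le_left _ _).trans (le_max_right _ _)
  have hdc : Continuous fun x => (ContinuousLinearMap.id ℝ E + fderiv ℝ b x).det := by
    have h2 := hb.continuous_fderiv one_ne_zero
    exact ContinuousLinearMap.continuous_det.comp (by fun_prop)
  obtain ⟨M, hM⟩ := hK.exists_bound_of_continuousOn hdc.continuousOn
  have hM0 : 0 ≤ M := (norm_nonneg _).trans (hM 0 (by simp [hR.le]))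
  set φ : E → ℝ := fun y => 1 - ‖y‖ ^ 2 / D ^ 2
  have hφc : Continuous φ := by fun_prop
  set a := 1 - r ^ 2 / D ^ 2
  set c := 1 - (r / 2) ^ 2 / D ^ 2
  have hD2 : 0 < D ^ 2 := by positivity
  have ha : 0 ≤ a := by
    simp only [a, sub_nonneg]
    rw [div_le_one hD2]; gcongr
  have hac : a < c := by
    simp only [a, c]
    gcongr 1 - ?_ / _
    gcongr
    linarith
  have hφ0 : ∀ y, ‖y‖ ≤ D → 0 ≤ φ y := fun y hy => by
    simp only [φ, sub_nonneg]
    rw [div_le_one hD2]; gcongr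
  have hφa : ∀ y, r ≤ ‖y‖ → φ y ≤ a := fun y hy => by
    simp only [φ, a]; gcongr
  have hφc' : ∀ y, ‖y‖ ≤ r / 2 → c ≤ φ y := fun y hy => by
    simp only [φ, c]; gcongr
  set V := volume.real (closedBall (0 : E) R)
  set v := volume.real (closedBall (0 : E) (r / 2))
  have hv : 0 < v := by
    refine ENNReal.toReal_pos (measure_closedBall_pos _ _ (by positivity)).ne' ?_
    exact (isCompact_closedBall _ _).measure_lt_top.ne
  -- The integral of `φ ^ N` is at least its part near `0`, where `φ ≥ c`; after the change of
  -- variables `φ` is only sampled where it is at most `a < c`.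
  have hkey : ∀ N : ℕ, v * c ^ N ≤ M * V * a ^ N := by
    intro N
    have hpoly : ∀ x u : E, ∃ p : ℝ[X], p.natDegree ≤ N * 2 ∧
        ∀ t, p.eval t = φ (x + t • u) ^ N := by
      intro x u
      refine ⟨(C (1 - ‖x‖ ^ 2 / D ^ 2) - C (2 * inner ℝ x u / D ^ 2) * X
        - C (‖u‖ ^ 2 / D ^ 2) * X ^ 2) ^ N, ?_, fun t => ?_⟩
      · refine natDegree_pow_le_of_le N ?_
        compute_degree
      · simp only [φ, eval_pow, eval_sub, eval_mul, eval_C, eval_X, norm_add_sq_real,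
          real_inner_smul_right, norm_smul, mul_pow, Real.norm_eq_abs, sq_abs]
        congr 1
        ring
    have heq := setIntegral_det_mul_eq hb hsupp (hφc.pow N) hpoly
    have hup : ∫ x in closedBall (0 : E) R,
        (ContinuousLinearMap.id ℝ E + fderiv ℝ b x).det * φ (x + b x) ^ N ≤ M * a ^ N * V := by
      refine (Real.le_norm_self _).trans (norm_setIntegral_le_of_norm_le_const hK.measure_lt_top ?_)
      intro x hx
      rw [norm_mul, norm_pow]
      have h0 := hφ0 (x + b x) ((hC₀ x hx).trans (le_max_left _ _))
      rw [Real.norm_of_nonneg h0]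
      exact mul_le_mul (hM x hx) (pow_le_pow_left₀ h0 (hφa _ (hlow x hx)) N) (by positivity) hM0
    have hlo : v * c ^ N ≤ ∫ x in closedBall (0 : E) R, φ x ^ N := by
      have h1 : v * c ^ N = ∫ x in closedBall (0 : E) (r / 2), c ^ N := by
        simp [v]
      rw [h1]
      have hi : ∀ s, IntegrableOn (fun x => φ x ^ N) (closedBall (0 : E) s) := fun s =>
        (hφc.pow N).continuousOn.integrableOn_compact (isCompact_closedBall 0 s)
      refine (setIntegral_mono_on (integrableOn_const (isCompact_closedBall _ _).measure_lt_top.ne)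
        (hi _) isClosed_closedBall.measurableSet fun x hx => ?_).trans
        (setIntegral_mono_set (hi R) ?_ ?_)
      · exact pow_le_pow_left₀ (ha.trans hac.le) (hφc' x (by simpa using hx)) N
      · refine (ae_restrict_iff' isClosed_closedBall.measurableSet).2 (Eventually.of_forall ?_)
        intro x hx
        exact pow_nonneg (hφ0 x ((by simpa using hx : ‖x‖ ≤ R).trans (le_max_right _ _))) N
      · exact (closedBall_subset_closedBall
          (by linarith [min_le_left R ‖x₀ + b x₀‖])).eventuallyLE
    calc v * c ^ N ≤ _ := hlo
      _ = _ := heq.symm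
      _ ≤ _ := hup
      _ = _ := by ring
  have hc : 0 < c := ha.trans_lt hac
  have hlim : Tendsto (fun N : ℕ => M * V * (a / c) ^ N) atTop (𝓝 (M * V * 0)) :=
    (tendsto_pow_atTop_nhds_zero_of_lt_one (by positivity) ((div_lt_one hc).2 hac)).const_mul _
  have : v ≤ M * V * 0 := ge_of_tendsto' hlim fun N => by
    have := hkey N
    rw [div_pow, ← mul_div_assoc, le_div_iff₀ (by positivity)]
    exact this
  linarith

/-- A compactly supported continuous perturbation of the identity has a zero. -/
theorem exists_add_eq_zero_of_hasCompactSupport {b : E → E} (hb : Continuous b)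
    (hcs : HasCompactSupport b) : ∃ x, x + b x = 0 := by
  have happ : ∀ n : ℕ, ∃ x, ‖x + b x‖ ≤ 1 / ((n : ℝ) + 1) := by
    intro n
    -- A zero of `x + g x` is an approximate zero of `x + b x`; compactness then yields an exact
    -- one.
    obtain ⟨g, hg, hgb, hgs⟩ := hb.exists_contDiff_approx 1 (ε := fun _ => 1 / ((n : ℝ) + 1))
      continuous_const (fun _ => by positivity)
    obtain ⟨x, hx⟩ := exists_add_eq_zero_of_contDiff hg
      (HasCompactSupport.of_support_subset_isCompact hcs (hgs.trans (subset_tsupport b)))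
    refine ⟨x, ?_⟩
    have : x + b x = b x - g x := by
      rw [← sub_eq_zero, ← hx]; abel
    rw [this, ← dist_eq_norm, dist_comm]
    exact (hgb x).le
  choose x hx using happ
  obtain ⟨K, hK⟩ := hcs.exists_bound_of_continuous hb
  have hmem : ∀ n, x n ∈ closedBall (0 : E) (K + 1) := by
    intro n
    rw [mem_closedBall_zero_iff]
    have h1 : 1 / ((n : ℝ) + 1) ≤ 1 := by
      rw [div_le_one (by positivity)]; linarith [(Nat.cast_nonneg n : (0 : ℝ) ≤ n)]
    have h2 : ‖x n‖ ≤ ‖x n + b (x n)‖ + ‖b (x n)‖ := by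
      simpa using norm_sub_le (x n + b (x n)) (b (x n))
    linarith [hx n, hK (x n)]
  obtain ⟨y, -, ψ, hψ, hlim⟩ := (isCompact_closedBall (0 : E) (K + 1)).tendsto_subseq hmem
  refine ⟨y, norm_le_zero_iff.1 ?_⟩
  have hc : Continuous fun x => ‖x + b x‖ := by fun_prop
  exact le_of_tendsto_of_tendsto' ((hc.tendsto y).comp hlim)
    (tendsto_one_div_add_atTop_nhds_zero_nat.comp hψ.tendsto_atTop) fun n => hx (ψ n)

/-- A bounded continuous perturbation of the identity has a zero. -/
theorem exists_add_eq_zero_of_bounded {b : E → E} (hb : Continuous b) {K : ℝ}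
    (hK : ∀ x, ‖b x‖ ≤ K) : ∃ x, x + b x = 0 := by
  have hK0 : 0 ≤ K := (norm_nonneg _).trans (hK 0)
  -- A zero of `x + χ x • b x` has norm at most `K`, where `χ = 1`.
  set χ : E → ℝ := fun x => max 0 (min 1 (K + 1 - ‖x‖))
  have hχ : Continuous χ := by fun_prop
  have hχ1 : ∀ x, |χ x| ≤ 1 := fun x => by
    rw [abs_of_nonneg (le_max_left _ _)]
    exact max_le zero_le_one (min_le_left _ _)
  obtain ⟨x, hx⟩ := exists_add_eq_zero_of_hasCompactSupport (b := fun x => χ x • b x)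
    (hχ.smul hb) (HasCompactSupport.of_support_subset_isCompact
      (isCompact_closedBall 0 (K + 1)) fun x hx => by
        by_contra h
        rw [mem_closedBall_zero_iff, not_le] at h
        refine hx ?_
        have : χ x = 0 := max_eq_left ((min_le_right _ _).trans (by linarith))
        simp [this])
  have hxK : ‖x‖ ≤ K := by
    rw [eq_neg_of_add_eq_zero_left hx, norm_neg, norm_smul]
    calc _ ≤ 1 * K := mul_le_mul (hχ1 x) (hK x) (norm_nonneg _) zero_le_one
      _ = K := one_mul K
  have : χ x = 1 := by
    simp only [χ]
    rw [min_eq_left (by linarith), max_eq_right zero_le_one]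
  exact ⟨x, by simpa [this] using hx⟩

end ZeroOfPerturbedIdentity

/-- The Poincaré–Miranda theorem: a continuous vector field on a box that points weakly outwards
on the faces of the box has a zero in the box. -/
theorem poincare_miranda {ι : Type*} [Fintype ι] {lo up : ι → ℝ} (hle : lo ≤ up)
    {F : (ι → ℝ) → ι → ℝ} (hF : ContinuousOn F (Icc lo up))
    (hlo : ∀ x ∈ Icc lo up, ∀ i, x i = lo i → F x i ≤ 0)
    (hup : ∀ x ∈ Icc lo up, ∀ i, x i = up i → 0 ≤ F x i) :
    ∃ x ∈ Icc lo up, F x = 0 := by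
  -- With `π` the retraction onto the box, a solution of `x + (F (π x) - π x) = 0` cannot leave the
  -- box: beyond a face, the sign of `F` there pushes `x i` back.
  set π : (ι → ℝ) → ι → ℝ := fun x => lo ⊔ (up ⊓ x)
  have hπc : Continuous π := continuous_pi fun i => by
    simp only [π, Pi.sup_apply, Pi.inf_apply]
    fun_prop
  have hπ : ∀ x, π x ∈ Icc lo up := fun x => ⟨le_sup_left, sup_le hle inf_le_left⟩
  have hG : Continuous fun x => F (π x) - π x :=
    (hF.comp_continuous hπc hπ).sub hπc
  obtain ⟨K, hK⟩ : ∃ K, ∀ x, ‖WithLp.toLp 2 (F (π x) - π x)‖ ≤ K := by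
    have hc : ContinuousOn (fun y => WithLp.toLp 2 (F y - y)) (Icc lo up) :=
      (PiLp.continuous_toLp 2 _).comp_continuousOn (hF.sub continuousOn_id)
    obtain ⟨K, hK⟩ := isCompact_Icc.exists_bound_of_continuousOn hc
    exact ⟨K, fun x => hK _ (hπ x)⟩
  obtain ⟨z, hz⟩ := exists_add_eq_zero_of_bounded (E := EuclideanSpace ℝ ι)
    (b := fun z => WithLp.toLp 2 (F (π z.ofLp) - π z.ofLp))
    ((PiLp.continuous_toLp 2 _).comp (hG.comp (PiLp.continuous_ofLp 2 _))) fun z => hK z.ofLp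
  set x : ι → ℝ := z.ofLp
  have hx : ∀ i, x i + (F (π x) i - π x i) = 0 := fun i => by
    simpa using congrArg (fun y : EuclideanSpace ℝ ι => y i) hz
  have hmem : x ∈ Icc lo up := by
    refine ⟨fun i => ?_, fun i => ?_⟩
    · by_contra! h
      have hi : π x i = lo i := sup_eq_left.2 (inf_le_right.trans h.le)
      linarith [hlo _ (hπ x) i hi, hx i]
    · by_contra! h
      have hi : π x i = up i := by
        simp only [π, Pi.sup_apply, Pi.inf_apply]
        rw [inf_eq_left.2 h.le, sup_eq_right.2 (hle i)]
      linarith [hup _ (hπ x) i hi, hx i]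
  have hπx : π x = x := by
    simp only [π]
    rw [inf_eq_right.2 hmem.2, sup_eq_right.2 hmem.1]
  exact ⟨x, hmem, funext fun i => by simpa [hπx] using hx i⟩

/-! ### Grid geometry and joint monotonicity -/

namespace LaxFriedrichs

variable {d : ℕ}

namespace Mesh

variable (M : Mesh d)

theorem h_pos (i : Fin d) : 0 < M.h i := by
  have h2 : (2 : ℝ) ≤ M.J i := by exact_mod_cast M.two_le_J i
  exact div_pos (sub_pos.2 (M.a_lt_b i)) (by linarith)

theorem hmax_nonneg : 0 ≤ M.hmax :=
  Real.iSup_nonneg fun i => (M.h_pos i).le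

theorem h_mul (i : Fin d) : M.h i * ((M.J i : ℝ) - 1) = M.b i - M.a i := by
  have h2 : (2 : ℝ) ≤ M.J i := by exact_mod_cast M.two_le_J i
  exact div_mul_cancel₀ _ (by linarith)

theorem node_mem_Ω_iff {α : Fin d → ℤ} :
    M.node α ∈ M.Ω ↔ ∀ i, 1 < α i ∧ α i < (M.J i : ℤ) := by
  simp only [Ω, mem_ofPred_eq, mem_Ioo, node]
  refine forall_congr' fun i => and_congr ?_ ?_
  · rw [lt_add_iff_pos_right, mul_pos_iff_of_pos_right (M.h_pos i), sub_pos]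
    exact_mod_cast Iff.rfl
  · have : M.b i = M.a i + ((M.J i : ℝ) - 1) * M.h i := by linarith [M.h_mul i]
    rw [this, add_lt_add_iff_left, mul_lt_mul_iff_left₀ (M.h_pos i), sub_lt_sub_iff_right]
    exact_mod_cast Iff.rfl

theorem mem_interiorIndices_iff {α : Fin d → ℤ} :
    α ∈ M.interiorIndices ↔ ∀ i, 1 < α i ∧ α i < (M.J i : ℤ) :=
  ⟨fun h => M.node_mem_Ω_iff.1 h.2,
    fun h => ⟨fun i => ⟨(h i).1.le, (h i).2.le⟩, M.node_mem_Ω_iff.2 h⟩⟩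

theorem Ω_eq_pi : M.Ω = univ.pi fun i => Ioo (M.a i) (M.b i) := by
  ext x
  simp [Ω]

theorem isOpen_Ω : IsOpen M.Ω := by
  rw [Ω_eq_pi]
  exact isOpen_set_pi finite_univ fun i _ => isOpen_Ioo

theorem node_mem_closure {α : Fin d → ℤ} (hα : α ∈ M.indices) : M.node α ∈ closure M.Ω := by
  rw [Ω_eq_pi, closure_pi_set]
  intro i _
  change M.node α i ∈ closure (Ioo (M.a i) (M.b i))
  rw [closure_Ioo (M.a_lt_b i).ne]
  have h1 : (1 : ℝ) ≤ α i := by exact_mod_cast (hα i).1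
  have h2 : (α i : ℝ) ≤ M.J i := by exact_mod_cast (hα i).2
  have h3 : M.b i = M.a i + ((M.J i : ℝ) - 1) * M.h i := by linarith [M.h_mul i]
  have h4 := M.h_pos i
  refine ⟨le_add_of_nonneg_right (mul_nonneg (by linarith) h4.le), ?_⟩
  rw [h3]
  simp only [node]
  gcongr

/-- The rectangle is open and its closure contains all grid nodes, so frontier membership becomes a
condition on indices. -/
theorem mem_boundaryIndices_iff {α : Fin d → ℤ} :
    α ∈ M.boundaryIndices ↔ α ∈ M.indices ∧ α ∉ M.interiorIndices := by
  simp only [boundaryIndices, interiorIndices, mem_ofPred_eq, M.isOpen_Ω.frontier_eq, mem_sdiff]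
  exact ⟨fun h => ⟨h.1, fun h' => h.2.2 h'.2⟩,
    fun h => ⟨h.1, M.node_mem_closure h.1, fun h' => h.2 ⟨h.1, h'⟩⟩⟩

theorem finite_indices : M.indices.Finite := by
  refine (finite_Icc (fun _ => 1) fun i => (M.J i : ℤ)).subset fun α hα => ?_
  exact ⟨fun i => (hα i).1, fun i => (hα i).2⟩

theorem e_self (i : Fin d) : e i i = 1 := Pi.single_eq_same i 1

theorem e_ne {i j : Fin d} (h : j ≠ i) : e i j = 0 := Pi.single_eq_of_ne h 1

/-- If `F` is monotone over an order interval, then `F V α` is nonincreasing in the nodal values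
other than `V α` jointly. -/
theorem MonotoneOver.le_of_le {M : Mesh d} {F : GridFunction d → (Fin d → ℤ) → ℝ}
    {Ulo Uup : GridFunction d} (hF : M.MonotoneOver F (M.orderInterval Ulo Uup))
    {α : Fin d → ℤ} (hα : α ∈ M.interiorIndices) {V W : GridFunction d}
    (hV : V ∈ M.orderInterval Ulo Uup) (hW : W ∈ M.orderInterval Ulo Uup)
    (hVW : ∀ κ ∈ M.indices, V κ ≤ W κ) (hVWα : V α = W α) : F W α ≤ F V α := by
  classical
  -- `V` is changed into `W` one node at a time; every intermediate function stays in the order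
  -- interval.
  have hmem : ∀ T : Finset (Fin d → ℤ), T.piecewise W V ∈ M.orderInterval Ulo Uup := by
    intro T κ hκ
    by_cases h : κ ∈ T
    · rw [Finset.piecewise_eq_of_mem _ _ _ h]; exact hW κ hκ
    · rw [Finset.piecewise_eq_of_notMem _ _ _ h]; exact hV κ hκ
  have hα' : ∀ T : Finset (Fin d → ℤ), T.piecewise W V α = W α := by
    intro T
    by_cases h : α ∈ T
    · rw [Finset.piecewise_eq_of_mem _ _ _ h]
    · rw [Finset.piecewise_eq_of_notMem _ _ _ h, hVWα]
  have hT : ∀ T : Finset (Fin d → ℤ), (∀ κ ∈ T, κ ∈ M.indices) →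
      F (T.piecewise W V) α ≤ F V α := by
    intro T
    induction T using Finset.induction_on with
    | empty => intro _; simp
    | insert a T ha ih =>
      intro hsub
      have haM := hsub a (Finset.mem_insert_self a T)
      refine le_trans ?_ (ih fun κ hκ => hsub κ (Finset.mem_insert_of_mem hκ))
      have hoff : ∀ κ ∈ M.indices, κ ≠ a →
          T.piecewise W V κ = (insert a T).piecewise W V κ := fun κ _ hκ => by
        rw [Finset.piecewise_insert, Function.update_of_ne hκ]
      by_cases hav : a = α
      · subst hav
        exact (hF a hα a haM _ (hmem _) _ (hmem _) (fun κ h1 h2 => (hoff κ h1 h2).symm)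
          (by rw [hα', hα'])).1 rfl
      · refine (hF α hα a haM _ (hmem _) _ (hmem _) hoff ?_).2 hav
        rw [Finset.piecewise_eq_of_notMem _ _ _ ha,
          Finset.piecewise_eq_of_mem _ _ _ (Finset.mem_insert_self a T)]
        exact hVW a haM
  have hfin := M.finite_indices
  refine le_trans ?_ (hT hfin.toFinset fun κ hκ => hfin.mem_toFinset.1 hκ)
  -- The two functions agree on the grid but perhaps not off it; monotonicity with equal nodal
  -- values absorbs this.
  refine (hF α hα α hα.1 W hW _ (hmem _) (fun κ hκ _ => ?_) (hα' _).ge).1 rfl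
  rw [Finset.piecewise_eq_of_mem _ _ _ (hfin.mem_toFinset.2 hκ)]

end Mesh

/-! ### Ghost points -/

/-- The value at the ghost point `κ` determined by the auxiliary boundary condition `bc` from the
values of `w` at the points `κ + s`, `κ + 2 s`, `κ + 3 s` of the grid. -/
def ghostValue (bc : AuxBC) (w : GridFunction d) (κ s : Fin d → ℤ) : ℝ :=
  match bc with
  | .linear => 2 * w (κ + s) - w (κ + 2 • s)
  | .quadratic => 3 * w (κ + s) - 3 * w (κ + 2 • s) + w (κ + 3 • s)

open Classical in
/-- The extension of the grid function `w` to the ghost points. -/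
def Mesh.withGhosts (M : Mesh d) (bc : AuxBC) (w : GridFunction d) : GridFunction d := fun κ =>
  if κ ∈ M.indices then w κ
  else if h : ∃ i, κ i = 0 then ghostValue bc w κ (e h.choose)
  else if h : ∃ i, κ i = M.J i + 1 then ghostValue bc w κ (-e h.choose)
  else 0

open Classical in
/-- The grid function with prescribed values at the interior nodes and the values `g` at the
other nodes. -/
def Mesh.gridValues (M : Mesh d) (g : (Fin d → ℝ) → ℝ) (x : M.interiorIndices → ℝ) :
    GridFunction d := fun κ =>
  if h : κ ∈ M.interiorIndices then x ⟨κ, h⟩ else g (M.node κ)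

namespace Mesh

variable (M : Mesh d) (bc : AuxBC) (w : GridFunction d)

theorem withGhosts_of_mem {κ : Fin d → ℤ} (h : κ ∈ M.indices) : M.withGhosts bc w κ = w κ :=
  if_pos h

theorem withGhosts_sub_e {α : Fin d → ℤ} {i : Fin d} (hα : α ∈ M.indices) (hi : α i = 1) :
    M.withGhosts bc w (α - e i) = ghostValue bc w (α - e i) (e i) := by
  have h0 : (α - e i) i = 0 := by simp [e_self, hi]
  have hout : α - e i ∉ M.indices := fun h => by
    have := (h i).1
    omega
  have hex : ∃ j, (α - e i) j = 0 := ⟨i, h0⟩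
  -- Only coordinate `i` has left its range, so the choice in `withGhosts` is forced.
  have hch : hex.choose = i := by
    by_contra h
    have h1 := hex.choose_spec
    have h2 := (hα hex.choose).1
    rw [Pi.sub_apply, e_ne h] at h1
    omega
  rw [withGhosts, if_neg hout, dif_pos hex, hch]

theorem withGhosts_add_e {α : Fin d → ℤ} {i : Fin d} (hα : α ∈ M.indices) (hi : α i = M.J i) :
    M.withGhosts bc w (α + e i) = ghostValue bc w (α + e i) (-e i) := by
  have h0 : (α + e i) i = M.J i + 1 := by simp [e_self, hi]
  have hout : α + e i ∉ M.indices := fun h => by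
    have := (h i).2
    omega
  have hnex : ¬∃ j, (α + e i) j = 0 := by
    rintro ⟨j, hj⟩
    have h2 := (hα j).1
    by_cases h : j = i
    · subst h
      omega
    · rw [Pi.add_apply, e_ne h] at hj
      omega
  have hex : ∃ j, (α + e i) j = M.J j + 1 := ⟨i, h0⟩
  have hch : hex.choose = i := by
    by_contra h
    have h1 := hex.choose_spec
    have h2 := (hα hex.choose).2
    rw [Pi.add_apply, e_ne h] at h1
    omega
  rw [withGhosts, if_neg hout, dif_neg hnex, dif_pos hex, hch]

/-- Here `s` is the inward direction; `δ2` is even in it, so opposite sides are treated together.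
The quadratic condition is the vanishing of a third difference. -/
theorem auxCondition_of_ghostValue {U : GridFunction d} {α s : Fin d → ℤ} {i : Fin d}
    (hs : s = e i ∨ s = -e i) (h0 : U α = w α) (h1 : U (α + s) = w (α + s))
    (h2 : U (α + 2 • s) = w (α + 2 • s)) (hg : U (α - s) = ghostValue bc w (α - s) s)
    (hout : α - s ∉ M.interiorIndices) : M.AuxCondition bc i U α := by
  have hδ : ∀ κ, M.δ2 i U κ = (U (κ + s) - 2 * U κ + U (κ - s)) / M.h i ^ 2 := by
    intro κ
    rcases hs with rfl | rfl
    · rfl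
    · rw [δ2, sub_neg_eq_add, ← sub_eq_add_neg]
      ring
  have e1 : α - s + s = α := by abel
  have e2 : α - s + 2 • s = α + s := by abel
  have e3 : α - s + 3 • s = α + 2 • s := by abel
  have e4 : α + s + s = α + 2 • s := by abel
  have e5 : α + s - s = α := by abel
  cases bc with
  | linear =>
    simp only [ghostValue, e1, e2] at hg
    simp only [AuxCondition, hδ, hg, h0, h1]
    ring
  | quadratic =>
    simp only [ghostValue, e1, e2, e3] at hg
    intro α' hα' hadj
    have : α' = α + s := by
      rcases hs with rfl | rfl <;> rcases hadj with rfl | rfl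
      · exact absurd hα' hout
      · rfl
      · abel
      · exact absurd hα' (by simpa using hout)
    rw [this, hδ, hδ, e4, e5, hg, h0, h1, h2]
    ring

theorem auxCondition_withGhosts {i : Fin d} {α : Fin d → ℤ} (hα : α ∈ M.sideIndices i) :
    M.AuxCondition bc i (M.withGhosts bc w) α := by
  obtain ⟨hαb, hside⟩ := hα
  obtain ⟨hαM, hαint⟩ := M.mem_boundaryIndices_iff.1 hαb
  -- An interior neighbour forces `J i ≥ 3`, so the second point inward is still on the grid.
  have hshift : ∀ c : ℤ, 1 ≤ α i + c → α i + c ≤ M.J i → α + c • e i ∈ M.indices := by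
    intro c h1 h2 j
    by_cases h : j = i
    · subst h
      simpa [e_self] using ⟨h1, h2⟩
    · simpa [e_ne h] using hαM j
  have hαi : (∀ j, j ≠ i → 1 < α j ∧ α j < (M.J j : ℤ)) → ¬(1 < α i ∧ α i < (M.J i : ℤ)) := by
    intro hj hi
    refine hαint (M.mem_interiorIndices_iff.2 fun j => ?_)
    by_cases h : j = i
    · exact h ▸ hi
    · exact hj j h
  have hi1 := (hαM i).1
  have hi2 := (hαM i).2
  rcases hside with h | h <;> have hn := M.mem_interiorIndices_iff.1 h
  · have hii := hn i
    have hlt := hαi fun j hj => by simpa [e_ne hj] using hn j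
    rw [Pi.add_apply, e_self] at hii
    have hα1 : α i = 1 := by omega
    refine M.auxCondition_of_ghostValue bc w (Or.inl rfl) (M.withGhosts_of_mem bc w hαM)
      (M.withGhosts_of_mem bc w h.1) (M.withGhosts_of_mem bc w ?_)
      (M.withGhosts_sub_e bc w hαM hα1) fun hc => ?_
    · have := hshift 2 (by omega) (by omega)
      simpa using this
    · have := M.mem_interiorIndices_iff.1 hc i
      rw [Pi.sub_apply, e_self] at this
      omega
  · have hii := hn i
    have hlt := hαi fun j hj => by simpa [e_ne hj] using hn j
    rw [Pi.sub_apply, e_self] at hii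
    have hαJ : α i = M.J i := by omega
    refine M.auxCondition_of_ghostValue bc w (s := -e i) (Or.inr rfl)
      (M.withGhosts_of_mem bc w hαM) (M.withGhosts_of_mem bc w ?_) (M.withGhosts_of_mem bc w ?_)
      ?_ fun hc => ?_
    · simpa [sub_eq_add_neg] using h.1
    · have := hshift (-2) (by omega) (by omega)
      simpa using this
    · rw [sub_neg_eq_add]
      exact M.withGhosts_add_e bc w hαM hαJ
    · have := M.mem_interiorIndices_iff.1 hc i
      rw [Pi.sub_apply, Pi.neg_apply, e_self] at this
      omega

theorem continuous_withGhosts {X : Type*} [TopologicalSpace X] {w : X → GridFunction d}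
    (hw : Continuous w) : Continuous fun x => M.withGhosts bc (w x) := by
  have hghost : ∀ κ s, Continuous fun x => ghostValue bc (w x) κ s := by
    intro κ s
    cases bc <;> simp only [ghostValue] <;> fun_prop
  refine continuous_pi fun κ => ?_
  simp only [withGhosts]
  split_ifs
  · fun_prop
  · exact hghost _ _
  · exact hghost _ _
  · exact continuous_const

theorem continuous_gridValues (g : (Fin d → ℝ) → ℝ) : Continuous (M.gridValues g) := by
  refine continuous_pi fun κ => ?_
  simp only [gridValues]
  split_ifs <;> fun_prop

end Mesh

/-! ### The modified operator: continuity and signs on the faces -/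

theorem cutoff_eq_max_min {lo up : ℝ} (h : lo ≤ up) (t : ℝ) :
    cutoff lo up t = max lo (min up t) := by
  unfold cutoff
  split_ifs with h1 h2
  · rw [min_eq_left h1.le, max_eq_right h]
  · rw [min_eq_right (by linarith), max_eq_left h2.le]
  · rw [min_eq_right (by linarith), max_eq_right (by linarith)]

namespace SchemeData

variable (P : SchemeData d) (M : Mesh d)

theorem continuous_Hmod
    (hH : ContinuousOn (fun z : (Fin d → ℝ) × ℝ × (Fin d → ℝ) => P.H z.1 z.2.1 z.2.2)
      (univ ×ˢ (univ ×ˢ M.Ω)))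
    {Ulo Uup : GridFunction d} {α : Fin d → ℤ} (hα : α ∈ M.interiorIndices)
    (hle : Ulo α ≤ Uup α) {X : Type*} [TopologicalSpace X] {U : X → GridFunction d}
    (hU : Continuous U) : Continuous fun x => P.Hmod M Ulo Uup (U x) α := by
  have hgrad : Continuous fun x => M.grad (U x) α := by
    refine continuous_pi fun i => ?_
    simp only [Mesh.grad, Mesh.δp, Mesh.δm]
    fun_prop
  have hlap : Continuous fun x => M.lap (U x) α := by
    simp only [Mesh.lap, Mesh.δ2]
    fun_prop
  have hHc : Continuous fun x => P.H (M.grad (U x) α) (U x α) (M.node α) :=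
    hH.comp_continuous (f := fun x => (M.grad (U x) α, U x α, M.node α)) (by fun_prop)
      fun x => ⟨mem_univ _, mem_univ _, hα.2⟩
  simp only [Hmod, HLF, Hh, cutoff_eq_max_min hle, Lp, Lm]
  fun_prop

/-- Each `V α` is paired with one truncated value, so the correction has a definite sign when `V α`
is an endpoint of the truncation interval. -/
theorem Hmod_eq (Ulo Uup V : GridFunction d) (α : Fin d → ℤ) :
    P.Hmod M Ulo Uup V α = P.HLF M V α + P.γ * M.hmax ^ P.p * (1 / 4) *
      ∑ i, 1 / M.h i ^ 2 * ((V α - cutoff (Ulo α) (Uup α) (Lp i V α)) +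
        (V α - cutoff (Ulo α) (Uup α) (Lm i V α))) := by
  have : ∑ i, 1 / M.h i ^ 2 * ((V α - cutoff (Ulo α) (Uup α) (Lp i V α)) +
        (V α - cutoff (Ulo α) (Uup α) (Lm i V α))) =
      2 * ∑ i, 1 / M.h i ^ 2 * V α - ∑ i, 1 / M.h i ^ 2 *
        (cutoff (Ulo α) (Uup α) (Lp i V α) + cutoff (Ulo α) (Uup α) (Lm i V α)) := by
    rw [Finset.mul_sum, ← Finset.sum_sub_distrib]
    exact Finset.sum_congr rfl fun i _ => by ring
  rw [Hmod, this]
  ring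

variable {P M} {Ulo Uup V : GridFunction d} {α : Fin d → ℤ}

theorem Hmod_nonneg (hγ : 0 < P.γ) (hsup : P.IsSupersolution M Uup)
    (hle : ∀ α ∈ M.indices, Ulo α ≤ Uup α)
    (hLF : M.MonotoneOver (P.HLF M) (M.orderInterval Ulo Uup))
    (hα : α ∈ M.interiorIndices) (hV : V ∈ M.orderInterval Ulo Uup) (hVα : V α = Uup α) :
    0 ≤ P.Hmod M Ulo Uup V α := by
  have h1 : 0 ≤ P.HLF M V α := (hsup.1 α hα).trans
    (hLF.le_of_le hα hV (fun κ hκ => ⟨hle κ hκ, le_rfl⟩) (fun κ hκ => (hV κ hκ).2) hVα)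
  have hcut : ∀ t, 0 ≤ V α - cutoff (Ulo α) (Uup α) t := fun t => by
    rw [cutoff_eq_max_min (hle α hα.1), hVα, sub_nonneg]
    exact max_le (hle α hα.1) (min_le_left _ _)
  have hc : 0 ≤ P.γ * M.hmax ^ P.p * (1 / 4) :=
    mul_nonneg (mul_nonneg hγ.le (Real.rpow_nonneg M.hmax_nonneg _)) (by norm_num)
  rw [Hmod_eq]
  exact add_nonneg h1 (mul_nonneg hc (Finset.sum_nonneg fun i _ =>
    mul_nonneg (by positivity) (add_nonneg (hcut _) (hcut _))))

theorem Hmod_nonpos (hγ : 0 < P.γ) (hsub : P.IsSubsolution M Ulo)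
    (hle : ∀ α ∈ M.indices, Ulo α ≤ Uup α)
    (hLF : M.MonotoneOver (P.HLF M) (M.orderInterval Ulo Uup))
    (hα : α ∈ M.interiorIndices) (hV : V ∈ M.orderInterval Ulo Uup) (hVα : V α = Ulo α) :
    P.Hmod M Ulo Uup V α ≤ 0 := by
  have h1 : P.HLF M V α ≤ 0 := (hLF.le_of_le hα (fun κ hκ => ⟨le_rfl, hle κ hκ⟩) hV
    (fun κ hκ => (hV κ hκ).1) hVα.symm).trans (hsub.1 α hα)
  have hcut : ∀ t, V α - cutoff (Ulo α) (Uup α) t ≤ 0 := fun t => by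
    rw [cutoff_eq_max_min (hle α hα.1), hVα, sub_nonpos]
    exact le_max_left _ _
  have hc : 0 ≤ P.γ * M.hmax ^ P.p * (1 / 4) :=
    mul_nonneg (mul_nonneg hγ.le (Real.rpow_nonneg M.hmax_nonneg _)) (by norm_num)
  rw [Hmod_eq]
  exact add_nonpos h1 (mul_nonpos_of_nonneg_of_nonpos hc (Finset.sum_nonpos fun i _ =>
    mul_nonpos_of_nonneg_of_nonpos (by positivity) (add_nonpos (hcut _) (hcut _))))

end SchemeData

end LaxFriedrichs

end

/-! ### Existence for the modified scheme -/

theorem mainTheorem2 {d : ℕ} (hd : 0 < d)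
    (M : LaxFriedrichs.Mesh d) (P : LaxFriedrichs.SchemeData d) (bc : LaxFriedrichs.AuxBC)
    (hθ : 0 < P.θ) (hβ : 0 ≤ P.β) (hγ : 0 < P.γ) (hp : P.p ∈ Set.Icc (0 : ℝ) 1)
    (hg : ContinuousOn P.g (frontier M.Ω))
    (hLip : LocallyLipschitzOn
      ((Set.univ : Set (Fin d → ℝ)) ×ˢ ((Set.univ : Set ℝ) ×ˢ M.Ω))
      (fun z : (Fin d → ℝ) × ℝ × (Fin d → ℝ) => P.H z.1 z.2.1 z.2.2))
    (hmono : ∀ (q : Fin d → ℝ), ∀ x ∈ M.Ω, Monotone (fun v : ℝ => P.H q v x))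
    (Ulo Uup : LaxFriedrichs.GridFunction d)
    (hsub : P.IsSubsolution M Ulo) (hsup : P.IsSupersolution M Uup)
    (hle : ∀ α ∈ M.indices, Ulo α ≤ Uup α)
    (hLF : M.MonotoneOver (P.HLF M) (M.orderInterval Ulo Uup)) :
    ∃ U : LaxFriedrichs.GridFunction d,
      P.IsModifiedSolution M bc Ulo Uup U ∧ U ∈ M.orderInterval Ulo Uup := by
  have hfin : Finite M.interiorIndices := (M.finite_indices.subset fun α hα => hα.1).to_subtype
  have := Fintype.ofFinite M.interiorIndices
  set lo : M.interiorIndices → ℝ := fun α => Ulo α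
  set up : M.interiorIndices → ℝ := fun α => Uup α
  set U : (M.interiorIndices → ℝ) → LaxFriedrichs.GridFunction d :=
    fun x => M.withGhosts bc (M.gridValues P.g x)
  have hUc : Continuous U := M.continuous_withGhosts bc (M.continuous_gridValues P.g)
  have hUint : ∀ x (α : M.interiorIndices), U x α = x α := fun x α => by
    simp only [U]
    rw [M.withGhosts_of_mem bc _ α.2.1, LaxFriedrichs.Mesh.gridValues, dif_pos α.2]
  have hUbd : ∀ x, ∀ α ∈ M.boundaryIndices, U x α = P.g (M.node α) := fun x α hα => by
    simp only [U]
    rw [M.withGhosts_of_mem bc _ hα.1, LaxFriedrichs.Mesh.gridValues,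
      dif_neg (M.mem_boundaryIndices_iff.1 hα).2]
  -- At boundary nodes the sub- and supersolution inequalities trap `g` between `Ulo` and `Uup`.
  have hUmem : ∀ x ∈ Set.Icc lo up, U x ∈ M.orderInterval Ulo Uup := by
    intro x hx α hα
    by_cases h : α ∈ M.interiorIndices
    · rw [hUint x ⟨α, h⟩]
      exact ⟨hx.1 ⟨α, h⟩, hx.2 ⟨α, h⟩⟩
    · have hb := M.mem_boundaryIndices_iff.2 ⟨hα, h⟩
      rw [hUbd x α hb]
      exact ⟨sub_nonpos.1 (hsub.2 α hb), sub_nonneg.1 (hsup.2 α hb)⟩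
  obtain ⟨x, hx, hx0⟩ := poincare_miranda (lo := lo) (up := up)
    (F := fun x (α : M.interiorIndices) => P.Hmod M Ulo Uup (U x) α) (fun α => hle α α.2.1)
    (continuous_pi fun α =>
      P.continuous_Hmod M hLip.continuousOn α.2 (hle _ α.2.1) hUc).continuousOn
    (fun x hx α h => LaxFriedrichs.SchemeData.Hmod_nonpos hγ hsub hle hLF α.2 (hUmem x hx)
      ((hUint x α).trans h))
    (fun x hx α h => LaxFriedrichs.SchemeData.Hmod_nonneg hγ hsup hle hLF α.2 (hUmem x hx)
      ((hUint x α).trans h))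
  exact ⟨U x, ⟨fun α hα => congrFun hx0 ⟨α, hα⟩, fun α hα => sub_eq_zero.2 (hUbd x α hα),
    fun i α hα => M.auxCondition_withGhosts bc _ hα⟩, hUmem x hx⟩
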